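/- Let $\mathcal A=\{H_1,\dots,H_l\}$ be an arrangement of pairwise distinct hyperplanes in $\mathbb{CP}^n$, ordered by their indices and defined by linear forms $\alpha_1,\dots,\alpha_l$. Its Orlik–Solomon algebra is $A=E/K$, where $E$ is the exterior algebra over $\mathbb C$ on generators $x_1,\dots,x_l$ and $K$ is the two-sided ideal generated by the elements $\sum_{j=1}^m(-1)^j x_{i_1}\wedge\cdots\wedge\widehat{x_{i_j}}\wedge\cdots\wedge x_{i_m}$ for all distinct $i_1,\dots,i_m$ with $\alpha_{i_1},\dots,\alpha_{i_m}$ linearly dependent, and by the monomials $x_{i_1}\wedge\cdots\wedge x_{i_m}$ with $H_{i_1}\cap\cdots\cap H_{i_m}=\emptyset$. A monomial $x_{i_1}\wedge\cdots\wedge x_{i_k}$ is called an NBC monomial (an element of the non broken circuit basis of $A$) if $k\le n$, $i_1<\cdots<i_k$, the forms $\alpha_{i_1},\dots,\alpha_{i_k}$ are linearly independent, and for each $j$ the hyperplane $H_{i_j}$ is the first one that contains $H_{i_j}\cap\cdots\cap H_{i_k}$. A flag $F=(S_n\supsetneq\cdots\supsetneq S_1)$ consists of nonempty intersections of hyperplanes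 of $\mathcal A$; put $j_{F,k}=\min\{j\mid S_k\subseteq H_j\}$. The flag is descendent if $j_{F,1}<\cdots<j_{F,n}$. Let $L=(H_{i_1},\dots,H_{i_n})$ be a tuple of hyperplanes with linearly independent forms. The flag $F$ is well fitted with respect to $L$ if there is a permutation $\sigma$ of $\{1,\dots,n\}$ with $S_k=\bigcap_{j=k}^n H_{i_{\sigma(j)}}$ for every $k$; this $\sigma$ is then unique, and $\mathrm{sig}_L(F)$ denotes its signature. Let $\mathrm{Desc}(L)$ be the finite set of descendent flags that are well fitted with respect to $L$. Then in $A$ $$x_{i_1}\wedge\cdots\wedge x_{i_n}=\sum_{F\in \mathrm{Desc}(L)}\mathrm{sig}_L(F)\,x_{j_{F,1}}\wedge\cdots\wedge x_{j_{F,n}},$$ and this is an expression in terms of the NBC basis: for each $F\in\mathrm{Desc}(L)$ the monomial $x_{j_{F,1}}\wedge\cdots\wedge x_{j_{F,n}}$ is an NBC monomial, and different flags in $\mathrm{Desc}(L)$ have different tuples $(j_{F,1},\dots,j_{F,n})$. -/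

import Mathlib

/-- A finite arrangement of `l` pairwise distinct hyperplanes in the complex projective space
`ℂℙⁿ`, ordered by their indices `0, …, l - 1`; the `i`-th hyperplane is the zero locus of the
nonzero linear form `form i` in the `n + 1` homogeneous coordinates. -/
structure HyperplaneArrangement (n l : ℕ) where
  form : Fin l → Module.Dual ℂ (Fin (n + 1) → ℂ)
  form_ne_zero : ∀ i, form i ≠ 0
  ker_injective : Function.Injective fun i => LinearMap.ker (form i)

namespace HyperplaneArrangement

variable {n l : ℕ} (A : HyperplaneArrangement n l)

/-- The `i`-th projective hyperplane, as a set of points of `ℂℙⁿ`. -/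
def H (i : Fin l) : Set (Projectivization ℂ (Fin (n + 1) → ℂ)) :=
  {p | p.submodule ≤ LinearMap.ker (A.form i)}

/-! ### The Orlik-Solomon algebra -/

/-- The monomial `x_{i_1} ∧ ⋯ ∧ x_{i_m}` in the exterior algebra `E` of `ℂ^l`. -/
noncomputable def extMonomial (l : ℕ) {m : ℕ} (i : Fin m → Fin l) :
    ExteriorAlgebra ℂ (Fin l → ℂ) :=
  ExteriorAlgebra.ιMulti ℂ m fun k => (Pi.single (i k) 1 : Fin l → ℂ)

/-- The element `∂ (x_{i_1} ∧ ⋯ ∧ x_{i_m}) = ∑ j, (-1)^j x_{i_1} ∧ ⋯ (omit x_{i_j}) ⋯ ∧ x_{i_m}`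
of `E`. Here `m` is the `m + 1` of the code, and the position `j` is counted from `0` in the code,
so that the sign is `(-1)^(j + 1)`. -/
noncomputable def extBoundary (l : ℕ) {m : ℕ} (i : Fin (m + 1) → Fin l) :
    ExteriorAlgebra ℂ (Fin l → ℂ) :=
  ∑ j : Fin (m + 1), (-1 : ℤ) ^ ((j : ℕ) + 1) • extMonomial l fun k => i (j.succAbove k)

/-- The generators of the Orlik-Solomon ideal: the boundaries of the monomials whose hyperplanes
intersect non generically (that is, their linear forms are dependent), and the monomials whose
hyperplanes have empty intersection in `ℂℙⁿ`. -/
inductive IsOSRelation : ExteriorAlgebra ℂ (Fin l → ℂ) → Prop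
  | boundary {m : ℕ} (i : Fin (m + 1) → Fin l) (hi : Function.Injective i)
      (hdep : ¬ LinearIndependent ℂ fun k => A.form (i k)) : IsOSRelation (extBoundary l i)
  | empty {m : ℕ} (i : Fin m → Fin l) (hempty : ⋂ k, A.H (i k) = ∅) :
      IsOSRelation (extMonomial l i)

/-- The two-sided ideal `K` of `E`. -/
def osIdeal : TwoSidedIdeal (ExteriorAlgebra ℂ (Fin l → ℂ)) :=
  TwoSidedIdeal.span {a | A.IsOSRelation a}

/-- The Orlik-Solomon algebra `E / K`. -/
abbrev OSAlgebra : Type := A.osIdeal.ringCon.Quotient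

/-- The monomial `x_{i_1} ∧ ⋯ ∧ x_{i_m}` in the Orlik-Solomon algebra. -/
noncomputable def monomial {m : ℕ} (i : Fin m → Fin l) : A.OSAlgebra :=
  A.osIdeal.ringCon.mk' (extMonomial l i)

/-- The tuple `i_1, …, i_k` indexes an element `x_{i_1} ∧ ⋯ ∧ x_{i_k}` of the non broken circuit
basis: `k ≤ n`, the tuple is increasing, its linear forms are independent, and for each `j` the
hyperplane `H_{i_j}` is the first one that contains `H_{i_j} ∩ ⋯ ∩ H_{i_k}`. -/
structure IsNBC {k : ℕ} (i : Fin k → Fin l) : Prop where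
  le : k ≤ n
  strictMono : StrictMono i
  linearIndependent : LinearIndependent ℂ fun j => A.form (i j)
  first : ∀ (j : Fin k) (a : Fin l), (⋂ m, ⋂ _ : j ≤ m, A.H (i m)) ⊆ A.H a → i j ≤ a

/-! ### Flags -/

/-- A flag `S_n ⊃ ⋯ ⊃ S_1` of nonempty projective subspaces, each of them an intersection of some
hyperplanes of the arrangement. The subspace `S_k` is `S (k - 1)` in the code. -/
@[ext]
structure Flag where
  S : Fin n → Set (Projectivization ℂ (Fin (n + 1) → ℂ))
  exists_eq : ∀ k, ∃ I : Finset (Fin l), I.Nonempty ∧ S k = ⋂ i ∈ I, A.H i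
  nonempty : ∀ k, (S k).Nonempty
  strictMono : StrictMono S

instance : Finite A.Flag := by
  choose I hI using fun (F : A.Flag) => F.exists_eq
  refine Finite.of_injective I fun F G h => Flag.ext (funext fun k => ?_)
  rw [(hI F k).2, (hI G k).2, h]

noncomputable instance : Fintype A.Flag := Fintype.ofFinite _

namespace Flag

variable {A} (F : A.Flag)

open Classical in
theorem index_nonempty (k : Fin n) :
    (Finset.univ.filter fun j : Fin l => F.S k ⊆ A.H j).Nonempty := by
  obtain ⟨I, ⟨i, hi⟩, hS⟩ := F.exists_eq k
  refine ⟨i, Finset.mem_filter.2 ⟨Finset.mem_univ i, ?_⟩⟩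
  rw [hS]
  exact Set.biInter_subset_of_mem hi

open Classical in
/-- The index `j_{F,k} = min {j | S_k ⊆ H_j}`. -/
noncomputable def index (k : Fin n) : Fin l :=
  (Finset.univ.filter fun j : Fin l => F.S k ⊆ A.H j).min' (F.index_nonempty k)

/-- The flag is descendent: `j_{F,1} < j_{F,2} < ⋯ < j_{F,n}`. -/
def IsDescendent : Prop := StrictMono F.index

/-- The flag is well fitted with respect to the tuple `L = (H_{i_1}, …, H_{i_n})` through the
permutation `σ`: `S_k = ⋂_{j ≥ k} H_{i_{σ(j)}}` for each `k`. -/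
def IsWellFittedVia (i : Fin n → Fin l) (σ : Equiv.Perm (Fin n)) : Prop :=
  ∀ k, F.S k = ⋂ j, ⋂ _ : k ≤ j, A.H (i (σ j))

/-- The flag is well fitted with respect to the tuple `L = (H_{i_1}, …, H_{i_n})`. -/
def IsWellFitted (i : Fin n → Fin l) : Prop := ∃ σ, F.IsWellFittedVia i σ

open Classical in
/-- The relative signature `sig_L(F)`: the signature of the permutation through which `F` is well
fitted with respect to `L`. That permutation is unique when `L` is linearly independent, see
`relSign_eq`. (The value is `0` if `F` is not well fitted.) -/
noncomputable def relSign (i : Fin n → Fin l) : ℤ :=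
  if h : F.IsWellFitted i then (Equiv.Perm.sign h.choose : ℤ) else 0

theorem mem_of_iInter_subset {A : HyperplaneArrangement n l} {i : Fin n → Fin l}
    (hi : LinearIndependent ℂ fun k => A.form (i k)) {P : Set (Fin n)} {a : Fin n}
    (h : (⋂ j ∈ P, A.H (i j)) ⊆ A.H (i a)) : a ∈ P := by
  have hker : (⨅ j : P, LinearMap.ker (A.form (i j))) ≤ LinearMap.ker (A.form (i a)) := by
    intro v hv
    by_cases hv0 : v = 0
    · simp [hv0]
    have hp : Projectivization.mk ℂ v hv0 ∈ ⋂ j ∈ P, A.H (i j) := by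
      simp only [Set.mem_iInter]
      intro j hj
      have := (Submodule.mem_iInf _).1 hv ⟨j, hj⟩
      simpa [H, Projectivization.submodule_mk, Submodule.span_singleton_le_iff_mem] using this
    have := h hp
    simpa [H, Projectivization.submodule_mk, Submodule.span_singleton_le_iff_mem] using this
  have hspan := mem_span_of_iInf_ker_le_ker (L := fun j : P => A.form (i j)) hker
  by_contra ha
  refine hi.notMem_span_image ha ?_
  rwa [Set.image_eq_range]

/-- The permutation through which a flag is well fitted is unique. -/
theorem isWellFittedVia_unique {F : A.Flag} {i : Fin n → Fin l}
    (hi : LinearIndependent ℂ fun k => A.form (i k)) {σ τ : Equiv.Perm (Fin n)}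
    (hσ : F.IsWellFittedVia i σ) (hτ : F.IsWellFittedVia i τ) : σ = τ := by
  have key : ∀ {σ τ : Equiv.Perm (Fin n)}, F.IsWellFittedVia i σ → F.IsWellFittedVia i τ →
      ∀ k, k ≤ τ.symm (σ k) := by
    intro σ τ hσ hτ k
    refine mem_of_iInter_subset (A := A) (i := fun j => i (τ j)) (P := {j | k ≤ j})
      (hi.comp τ τ.injective) ?_
    have h1 : (⋂ j ∈ {j | k ≤ j}, A.H (i (τ j))) = F.S k := (hτ k).symm
    rw [h1, hσ k, Equiv.apply_symm_apply]
    exact Set.iInter₂_subset k le_rfl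
  ext1 k
  have h1 := key hσ hτ k
  have h2 := key hτ hσ (τ.symm (σ k))
  rw [Equiv.apply_symm_apply, Equiv.symm_apply_apply] at h2
  rw [← Equiv.symm_apply_eq]
  exact le_antisymm h2 h1

theorem relSign_eq {F : A.Flag} {i : Fin n → Fin l}
    (hi : LinearIndependent ℂ fun k => A.form (i k)) {σ : Equiv.Perm (Fin n)}
    (hσ : F.IsWellFittedVia i σ) : F.relSign i = Equiv.Perm.sign σ := by
  have h : F.IsWellFitted i := ⟨σ, hσ⟩
  rw [relSign, dif_pos h, isWellFittedVia_unique hi h.choose_spec hσ]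

end Flag

open Classical in
/-- The set `Desc(L)` of the descendent flags that are well fitted with respect to `L`. -/
noncomputable def desc (i : Fin n → Fin l) : Finset A.Flag :=
  Finset.univ.filter fun F => F.IsDescendent ∧ F.IsWellFitted i

end HyperplaneArrangement

/-! The Orlik–Solomon relation of a dependent tuple `a, i_1, …, i_m`, with `a` the smallest
hyperplane containing `⋂ H_{i_k}`, lets `x_a` replace each factor of `x_{i_1} ∧ ⋯ ∧ x_{i_m}` in
turn: the monomial is the sum of the `m` monomials so obtained. Moving `x_a` to the front and
iterating on the remaining factors expands the monomial as a signed sum over all orderings of the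
tuple, where an ordering contributes the monomial of the smallest hyperplanes containing its
successive tails `⋂_{r ≥ k} H_{i_{σ(r)}}`. These smallest indices are weakly increasing, so a term
vanishes unless they increase strictly, which is to say that the tails form a descendent flag.
When they do increase strictly, their forms are independent, so by dimension count they cut out the
same tails. Hence they determine the flag and index an NBC monomial. -/

section LinearIndependence

open Submodule

variable {ι K V : Type*} [DivisionRing K] [AddCommGroup V] [Module K V]

theorem linearIndependent_of_notMem_span_image_Ioi [LinearOrder ι] {v : ι → V}
    (h : ∀ k, v k ∉ span K (v '' Set.Ioi k)) : LinearIndependent K v := by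
  refine linearIndependent_iff_finset_linearIndependent.2 fun s => ?_
  change LinearIndepOn K v s
  induction s using Finset.induction_on_min with
  | empty => simp
  | insert a s ha ih =>
    rw [Finset.coe_insert]
    exact ih.insert fun hmem => h a (span_mono (Set.image_mono ha) hmem)

variable [Finite ι] {v w : ι → V}

theorem linearIndependent_of_forall_mem_span_range (hw : LinearIndependent K w)
    (h : ∀ k, w k ∈ span K (Set.range v)) : LinearIndependent K v := by
  have := Fintype.ofFinite ι
  have := FiniteDimensional.span_of_finite K (Set.finite_range v)
  rw [linearIndependent_iff_card_le_finrank_span, ← finrank_span_eq_card hw]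
  exact finrank_mono (span_le.2 (Set.range_subset_iff.2 h))

theorem span_range_eq_of_forall_mem_span_range (hw : LinearIndependent K w)
    (h : ∀ k, w k ∈ span K (Set.range v)) : span K (Set.range w) = span K (Set.range v) := by
  have := Fintype.ofFinite ι
  have := FiniteDimensional.span_of_finite K (Set.finite_range v)
  refine eq_of_le_of_finrank_le (span_le.2 (Set.range_subset_iff.2 h)) ?_
  rw [finrank_span_eq_card hw]
  exact finrank_range_le_card v

end LinearIndependence

theorem tail_comp_decomposeFin_symm {m : ℕ} {α : Type*} (f : Fin (m + 1) → α) (p : Fin (m + 1))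
    (e : Equiv.Perm (Fin m)) : Fin.tail (f ∘ Equiv.Perm.decomposeFin.symm (p, e)) =
      Fin.tail (f ∘ Equiv.swap 0 p) ∘ e :=
  funext fun k => congrArg f (Equiv.Perm.decomposeFin_symm_apply_succ e p k)

namespace HyperplaneArrangement

variable {n l : ℕ} {A : HyperplaneArrangement n l}

theorem mk_mem_H_iff {v : Fin (n + 1) → ℂ} (hv : v ≠ 0) {a : Fin l} :
    Projectivization.mk ℂ v hv ∈ A.H a ↔ A.form a v = 0 := by
  simp [H, Projectivization.submodule_mk, Submodule.span_singleton_le_iff_mem]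

theorem iInter_H_subset_iff {ι : Type*} {i : ι → Fin l} {a : Fin l} :
    (⋂ k, A.H (i k)) ⊆ A.H a ↔ A.form a ∈ Submodule.span ℂ (Set.range (A.form ∘ i)) := by
  refine ⟨fun h => FiniteDimensional.mem_span_of_iInf_ker_le_ker fun v hv => ?_, fun h p hp => ?_⟩
  · obtain rfl | hv0 := eq_or_ne v 0
    · exact zero_mem _
    refine (mk_mem_H_iff hv0).1 (h (Set.mem_iInter.2 fun k => (mk_mem_H_iff hv0).2 ?_))
    exact (Submodule.mem_iInf _).1 hv k
  · induction p with
    | h v hv =>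
      have hspan : Submodule.span ℂ (Set.range (A.form ∘ i)) ≤
          LinearMap.ker (LinearMap.applyₗ (R := ℂ) (M₂ := ℂ) v) :=
        Submodule.span_le.2 (Set.range_subset_iff.2 fun k =>
          (mk_mem_H_iff hv).1 (Set.mem_iInter.1 hp k))
      exact (mk_mem_H_iff hv).2 (hspan h)

theorem iInter_H_nonempty {m : ℕ} (hm : m ≤ n) (i : Fin m → Fin l) :
    (⋂ k, A.H (i k)).Nonempty := by
  have hker : LinearMap.ker (LinearMap.pi fun k => A.form (i k)) ≠ ⊥ :=
    LinearMap.ker_ne_bot_of_finrank_lt (by simpa using Nat.lt_succ_of_le hm)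
  obtain ⟨v, hv, hv0⟩ := Submodule.exists_mem_ne_zero_of_ne_bot hker
  exact ⟨.mk ℂ v hv0, Set.mem_iInter.2 fun k => (mk_mem_H_iff hv0).2 (congrFun hv k)⟩

/-! ### Tails of a tuple of hyperplanes -/

section Tail

section Preorder

variable {ι : Type*} [Preorder ι] {i : ι → Fin l} {k : ι} {a : Fin l}

variable (A) in
/-- The tail `⋂_{r ≥ k} H_{i_r}` of a tuple of hyperplanes; the tails of a reordering of `L` are
the members of a flag that is well fitted with respect to `L`. -/
def tailInter (i : ι → Fin l) (k : ι) : Set (Projectivization ℂ (Fin (n + 1) → ℂ)) :=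
  ⋂ r, ⋂ _ : k ≤ r, A.H (i r)

theorem tailInter_subset_iff :
    A.tailInter i k ⊆ A.H a ↔ A.form a ∈ Submodule.span ℂ ((A.form ∘ i) '' Set.Ici k) := by
  rw [Set.image_eq_range, tailInter, ← Set.iInter_subtype (k ≤ ·) fun r => A.H (i r)]
  exact iInter_H_subset_iff

theorem tailInter_subset_self (i : ι → Fin l) (k : ι) : A.tailInter i k ⊆ A.H (i k) :=
  Set.iInter₂_subset k le_rfl

theorem tailInter_monotone (i : ι → Fin l) : Monotone (A.tailInter i) :=
  fun _ _ h => Set.iInter_mono fun _ => Set.iInter_mono' fun hk => ⟨h.trans hk, le_rfl⟩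

theorem tailInter_of_isBot (i : ι → Fin l) (hk : IsBot k) : A.tailInter i k = ⋂ r, A.H (i r) := by
  simp only [tailInter, hk _, Set.iInter_true]

variable (A) in
open Classical in
/-- The smallest index of a hyperplane containing the tail `⋂_{r ≥ k} H_{i_r}`; this is `j_{F,k}`
if the tails are the members of the flag `F`. -/
noncomputable def minIndex (i : ι → Fin l) (k : ι) : Fin l :=
  (Finset.univ.filter fun j : Fin l => A.tailInter i k ⊆ A.H j).min'
    ⟨i k, by simpa using tailInter_subset_self i k⟩

theorem isLeast_minIndex (i : ι → Fin l) (k : ι) :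
    IsLeast {j | A.tailInter i k ⊆ A.H j} (A.minIndex i k) := by
  classical
  rw [← Finset.coe_filter_univ]
  exact Finset.isLeast_min' _ _

theorem tailInter_subset_minIndex (i : ι → Fin l) (k : ι) :
    A.tailInter i k ⊆ A.H (A.minIndex i k) :=
  (isLeast_minIndex i k).1

theorem minIndex_le (h : A.tailInter i k ⊆ A.H a) : A.minIndex i k ≤ a :=
  (isLeast_minIndex i k).2 h

theorem minIndex_congr {κ : Type*} [Preorder κ] {j : κ → Fin l} {q : κ}
    (h : A.tailInter i k = A.tailInter j q) : A.minIndex i k = A.minIndex j q :=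
  (isLeast_minIndex i k).unique (h ▸ isLeast_minIndex j q)

theorem minIndex_monotone (i : ι → Fin l) : Monotone (A.minIndex i) :=
  fun _ k h => minIndex_le ((tailInter_monotone i h).trans (tailInter_subset_minIndex i k))

theorem tailInter_subset_tailInter_minIndex (i : ι → Fin l) (k : ι) :
    A.tailInter i k ⊆ A.tailInter (A.minIndex i) k :=
  Set.subset_iInter₂ fun r hr => (tailInter_monotone i hr).trans (tailInter_subset_minIndex i r)

end Preorder

theorem tailInter_strictMono {ι : Type*} [PartialOrder ι] {i : ι → Fin l}
    (h : StrictMono (A.minIndex i)) : StrictMono (A.tailInter i) :=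
  fun _ _ hjk => (tailInter_monotone i hjk.le).lt_of_ne fun heq =>
    (h hjk).ne (minIndex_congr heq)

section LinearOrder

variable {ι : Type*} [LinearOrder ι] [SuccOrder ι] {i : ι → Fin l}

theorem linearIndependent_form_minIndex (h : StrictMono (A.minIndex i)) :
    LinearIndependent ℂ (A.form ∘ A.minIndex i) := by
  refine linearIndependent_of_notMem_span_image_Ioi fun k hmem => ?_
  by_cases hk : IsMax k
  · rw [hk.Ioi_eq, Set.image_empty, Submodule.span_empty] at hmem
    exact A.form_ne_zero _ hmem
  · rw [← Order.Ici_succ_of_not_isMax hk] at hmem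
    have hsub : A.tailInter i (Order.succ k) ⊆ A.H (A.minIndex i k) :=
      (tailInter_subset_tailInter_minIndex i _).trans (tailInter_subset_iff.2 hmem)
    exact (h (Order.lt_succ_of_not_isMax hk)).not_ge (minIndex_le hsub)

variable [Finite ι]

theorem linearIndependent_form_of_strictMono_minIndex (h : StrictMono (A.minIndex i)) :
    LinearIndependent ℂ (A.form ∘ i) :=
  linearIndependent_of_forall_mem_span_range (linearIndependent_form_minIndex h) fun k =>
    Submodule.span_mono (Set.image_subset_range _ _)
      (tailInter_subset_iff.1 (tailInter_subset_minIndex i k))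

theorem tailInter_minIndex (h : StrictMono (A.minIndex i)) :
    A.tailInter (A.minIndex i) = A.tailInter i := by
  funext k
  have hspan : Submodule.span ℂ ((A.form ∘ A.minIndex i) '' Set.Ici k) =
      Submodule.span ℂ ((A.form ∘ i) '' Set.Ici k) := by
    rw [Set.image_eq_range, Set.image_eq_range]
    refine span_range_eq_of_forall_mem_span_range
      ((linearIndependent_form_minIndex h).comp _ Subtype.val_injective) fun r => ?_
    rw [← Set.image_eq_range]
    exact tailInter_subset_iff.1 ((tailInter_monotone i r.2).trans (tailInter_subset_minIndex i r))
  refine (Set.subset_iInter₂ fun r hr => ?_).antisymm (tailInter_subset_tailInter_minIndex i k)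
  rw [tailInter_subset_iff, hspan]
  exact Submodule.subset_span (Set.mem_image_of_mem _ hr)

end LinearOrder

variable {m : ℕ}

theorem isNBC_minIndex (hm : m ≤ n) {i : Fin m → Fin l} (h : StrictMono (A.minIndex i)) :
    A.IsNBC (A.minIndex i) where
  le := hm
  strictMono := h
  linearIndependent := linearIndependent_form_minIndex h
  first j _ hj := minIndex_le ((congrFun (tailInter_minIndex h) j).superset.trans hj)

theorem tailInter_succ (i : Fin (m + 1) → Fin l) (k : Fin m) :
    A.tailInter i k.succ = A.tailInter (Fin.tail i) k := by
  ext p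
  simp only [tailInter, Set.mem_iInter, Fin.forall_fin_succ, Fin.succ_le_succ_iff, Fin.tail]
  simp

theorem minIndex_comp_perm_zero (i : Fin (m + 1) → Fin l) (σ : Equiv.Perm (Fin (m + 1))) :
    A.minIndex (i ∘ σ) 0 = A.minIndex i 0 := by
  refine minIndex_congr ?_
  rw [tailInter_of_isBot _ Fin.zero_le, tailInter_of_isBot _ Fin.zero_le]
  exact σ.surjective.iInter_comp fun r => A.H (i r)

theorem minIndex_eq_cons (i : Fin (m + 1) → Fin l) :
    A.minIndex i = Fin.cons (A.minIndex i 0) (A.minIndex (Fin.tail i)) := by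
  rw [← Fin.cons_self_tail (A.minIndex i)]
  exact congrArg _ (funext fun k => minIndex_congr (tailInter_succ i k))

end Tail

/-! ### Monomials of the Orlik–Solomon algebra -/

section Monomial

variable {m : ℕ}

theorem monomial_cons (a : Fin l) (i : Fin m → Fin l) :
    A.monomial (Fin.cons a i : Fin (m + 1) → Fin l) = A.monomial ![a] * A.monomial i := by
  have hmul : extMonomial l (Fin.cons a i : Fin (m + 1) → Fin l) =
      extMonomial l ![a] * extMonomial l i := by
    simp only [extMonomial, ExteriorAlgebra.ιMulti_succ_apply, ExteriorAlgebra.ιMulti_zero_apply,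
      mul_one]
    rfl
  rw [monomial, hmul, map_mul, monomial, monomial]

theorem monomial_eq_zero_of_not_injective {i : Fin m → Fin l} (h : ¬ Function.Injective i) :
    A.monomial i = 0 := by
  have hext : extMonomial l i = 0 :=
    AlternatingMap.map_eq_zero_of_not_injective _ _ fun hsingle =>
      h (Function.Injective.of_comp (f := fun a => (Pi.single a 1 : Fin l → ℂ)) hsingle)
  rw [monomial, hext, map_zero]

theorem monomial_comp_perm (i : Fin m → Fin l) (σ : Equiv.Perm (Fin m)) :
    A.monomial (i ∘ σ) = (Equiv.Perm.sign σ : ℤ) • A.monomial i := by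
  rw [monomial, monomial, ← map_zsmul]
  exact congrArg _ (AlternatingMap.map_perm (ExteriorAlgebra.ιMulti ℂ m)
    (fun k => (Pi.single (i k) 1 : Fin l → ℂ)) σ)

theorem monomial_insertNth (p : Fin (m + 1)) (a : Fin l) (i : Fin m → Fin l) :
    A.monomial (p.insertNth a i : Fin (m + 1) → Fin l) =
      (-1 : ℤ) ^ (p : ℕ) • A.monomial (Fin.cons a i : Fin (m + 1) → Fin l) := by
  rw [← Fin.cons_comp_cycleRange, monomial_comp_perm, Fin.sign_cycleRange]
  simp

theorem monomial_update (i : Fin (m + 1) → Fin l) (p : Fin (m + 1)) (a : Fin l) :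
    A.monomial (Function.update i p a) = (Equiv.Perm.sign (Equiv.swap 0 p) : ℤ) •
      A.monomial (Fin.cons a (Fin.tail (i ∘ Equiv.swap 0 p)) : Fin (m + 1) → Fin l) := by
  rw [← monomial_comp_perm, ← Fin.removeNth_zero, ← Fin.insertNth_zero', Fin.insertNth_removeNth,
    Function.update_comp_equiv]
  simp [Function.comp_assoc, ← Equiv.Perm.coe_mul]

theorem sum_monomial_removeNth_eq_zero {i : Fin (m + 1) → Fin l} (hi : Function.Injective i)
    (hdep : ¬ LinearIndependent ℂ (A.form ∘ i)) :
    ∑ j : Fin (m + 1), (-1 : ℤ) ^ (j : ℕ) • A.monomial (j.removeNth i) = 0 := by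
  have hmem : extBoundary l i ∈ A.osIdeal :=
    TwoSidedIdeal.subset_span (IsOSRelation.boundary i hi hdep)
  have hzero : A.osIdeal.ringCon.mk' (extBoundary l i) = 0 := by
    rwa [← TwoSidedIdeal.mem_ker, TwoSidedIdeal.ker_ringCon_mk']
  simp only [extBoundary, pow_succ, mul_neg_one, neg_smul, Finset.sum_neg_distrib, map_neg,
    neg_eq_zero, map_sum, map_zsmul] at hzero
  exact hzero

theorem monomial_eq_sum_update {i : Fin (m + 1) → Fin l} (hi : Function.Injective i) {a : Fin l}
    (ha : (⋂ k, A.H (i k)) ⊆ A.H a) :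
    A.monomial i = ∑ p, A.monomial (Function.update i p a) := by
  by_cases hmem : a ∈ Set.range i
  · obtain ⟨q, rfl⟩ := hmem
    rw [Finset.sum_eq_single_of_mem q (Finset.mem_univ q), Function.update_eq_self]
    refine fun p _ hpq => monomial_eq_zero_of_not_injective fun hinj => hpq (hinj ?_)
    rw [Function.update_self, Function.update_of_ne hpq.symm]
  · have hdep : ¬ LinearIndependent ℂ (A.form ∘ (Fin.cons a i : Fin (m + 2) → Fin l)) :=
      fun h => (linearIndependent_finSucc.1 h).2 (iInter_H_subset_iff.1 ha)
    have hrel := sum_monomial_removeNth_eq_zero (Fin.cons_injective_iff.2 ⟨hmem, hi⟩) hdep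
    have hterm (p : Fin (m + 1)) :
        (-1 : ℤ) ^ (p : ℕ) • A.monomial (p.succ.removeNth (Fin.cons a i : Fin (m + 2) → Fin l)) =
          A.monomial (Function.update i p a) := by
      rw [← Fin.insertNth_removeNth, monomial_insertNth]
      congr 2
      funext k
      cases k using Fin.cases <;> simp [Fin.removeNth]
    rw [Fin.sum_univ_succ, Fin.val_zero, pow_zero, one_smul, Fin.removeNth_zero, Fin.tail_cons]
      at hrel
    simp only [Fin.val_succ, pow_succ, mul_neg_one, neg_smul, hterm, Finset.sum_neg_distrib,
      add_neg_eq_zero] at hrel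
    exact hrel

theorem monomial_eq_sum_perm {i : Fin m → Fin l} (hi : Function.Injective i) :
    A.monomial i = ∑ σ : Equiv.Perm (Fin m),
      (Equiv.Perm.sign σ : ℤ) • A.monomial (A.minIndex (i ∘ σ)) := by
  induction m with
  | zero => simp [Subsingleton.elim (A.minIndex _) i]
  | succ m ih =>
    set a := A.minIndex i 0
    have hsub : (⋂ k, A.H (i k)) ⊆ A.H a := by
      rw [← tailInter_of_isBot i Fin.zero_le]
      exact tailInter_subset_minIndex i 0
    have hminIndex (p : Fin (m + 1)) (e : Equiv.Perm (Fin m)) :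
        A.minIndex (i ∘ Equiv.Perm.decomposeFin.symm (p, e)) =
          Fin.cons a (A.minIndex (Fin.tail (i ∘ Equiv.swap 0 p) ∘ e)) := by
      rw [minIndex_eq_cons, minIndex_comp_perm_zero, tail_comp_decomposeFin_symm]
    rw [monomial_eq_sum_update hi hsub, ← Equiv.Perm.decomposeFin.symm.sum_comp,
      Fintype.sum_prod_type]
    refine Finset.sum_congr rfl fun p _ => ?_
    have htail : Function.Injective (Fin.tail (i ∘ Equiv.swap 0 p)) :=
      (hi.comp (Equiv.injective _)).comp (Fin.succ_injective m)
    rw [monomial_update, monomial_cons, ih htail, Finset.mul_sum, Finset.smul_sum]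
    refine Finset.sum_congr rfl fun e _ => ?_
    rw [hminIndex, monomial_cons, Equiv.Perm.decomposeFin.symm_sign, Equiv.swap_comm,
      Equiv.Perm.sign_swap', mul_smul_comm, smul_smul, Units.val_mul]

end Monomial

/-! ### Descendent flags -/

section DescendentOrdering

variable {m : ℕ}

variable (A) in
/-- The orderings `σ` of a tuple `L` whose tails `⋂_{r ≥ k} H_{i_{σ(r)}}` have strictly increasing
smallest indices; they parametrize `Desc(L)`. -/
abbrev DescendentOrdering (i : Fin m → Fin l) : Type :=
  {σ : Equiv.Perm (Fin m) // StrictMono (A.minIndex (i ∘ σ))}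

theorem DescendentOrdering.linearIndependent {i : Fin m → Fin l} (σ : A.DescendentOrdering i) :
    LinearIndependent ℂ (A.form ∘ i) :=
  (linearIndependent_equiv σ.1).1 (linearIndependent_form_of_strictMono_minIndex σ.2)

open Classical in
theorem monomial_eq_sum_descendentOrdering (i : Fin m → Fin l) :
    A.monomial i = ∑ σ : A.DescendentOrdering i,
      (Equiv.Perm.sign σ.1 : ℤ) • A.monomial (A.minIndex (i ∘ σ.1)) := by
  by_cases hi : Function.Injective i
  · rw [monomial_eq_sum_perm hi]
    refine (Fintype.sum_of_injective _ Subtype.val_injective _ _ (fun σ hσ => ?_) fun _ => rfl).symm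
    rw [monomial_eq_zero_of_not_injective, smul_zero]
    exact fun hinj => hσ ⟨⟨σ, (minIndex_monotone _).strictMono_of_injective hinj⟩, rfl⟩
  · have : IsEmpty (A.DescendentOrdering i) :=
      ⟨fun σ => hi (Function.Injective.of_comp σ.linearIndependent.injective)⟩
    rw [monomial_eq_zero_of_not_injective hi, Fintype.sum_empty]

variable {i : Fin n → Fin l}

/-- The flag of the tails `⋂_{r ≥ k} H_{i_{σ(r)}}`. -/
def DescendentOrdering.flag (σ : A.DescendentOrdering i) : A.Flag where
  S := A.tailInter (i ∘ σ.1)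
  exists_eq k := ⟨(Finset.Ici k).image (i ∘ σ.1), Finset.nonempty_Ici.image _, by
    simp [tailInter]⟩
  nonempty _ := (iInter_H_nonempty le_rfl (i ∘ σ.1)).mono
    (Set.subset_iInter₂ fun r _ => Set.iInter_subset _ r)
  strictMono := tailInter_strictMono σ.2

theorem DescendentOrdering.index_flag (σ : A.DescendentOrdering i) :
    σ.flag.index = A.minIndex (i ∘ σ.1) :=
  rfl

theorem DescendentOrdering.isWellFittedVia_flag (σ : A.DescendentOrdering i) :
    σ.flag.IsWellFittedVia i σ.1 :=
  fun _ => rfl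

theorem DescendentOrdering.relSign_flag (σ : A.DescendentOrdering i) :
    σ.flag.relSign i = Equiv.Perm.sign σ.1 :=
  Flag.relSign_eq σ.linearIndependent σ.isWellFittedVia_flag

theorem DescendentOrdering.flag_injective :
    Function.Injective (flag : A.DescendentOrdering i → A.Flag) := fun σ τ h =>
  Subtype.ext (Flag.isWellFittedVia_unique σ.linearIndependent σ.isWellFittedVia_flag
    (h ▸ τ.isWellFittedVia_flag))

theorem mem_desc_iff_exists_flag_eq {F : A.Flag} :
    F ∈ A.desc i ↔ ∃ σ : A.DescendentOrdering i, σ.flag = F := by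
  simp only [desc, Finset.mem_filter_univ]
  constructor
  · rintro ⟨hdesc, σ, hσ⟩
    obtain ⟨S, _, _, _⟩ := F
    obtain rfl : S = A.tailInter (i ∘ σ) := funext hσ
    exact ⟨⟨σ, hdesc⟩, rfl⟩
  · rintro ⟨σ, rfl⟩
    exact ⟨σ.2, σ.1, σ.isWellFittedVia_flag⟩

theorem isNBC_index_of_mem_desc {F : A.Flag} (hF : F ∈ A.desc i) : A.IsNBC F.index := by
  obtain ⟨σ, rfl⟩ := mem_desc_iff_exists_flag_eq.1 hF
  exact isNBC_minIndex le_rfl σ.2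

theorem tailInter_index_of_mem_desc {F : A.Flag} (hF : F ∈ A.desc i) :
    A.tailInter F.index = F.S := by
  obtain ⟨σ, rfl⟩ := mem_desc_iff_exists_flag_eq.1 hF
  exact tailInter_minIndex σ.2

theorem injOn_index_desc : Set.InjOn (fun F : A.Flag => F.index) (A.desc i) := fun _ hF _ hG h =>
  Flag.ext ((tailInter_index_of_mem_desc hF).symm.trans
    ((congrArg A.tailInter h).trans (tailInter_index_of_mem_desc hG)))

theorem monomial_eq_sum_desc (i : Fin n → Fin l) :
    A.monomial i = ∑ F ∈ A.desc i, F.relSign i • A.monomial F.index := by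
  rw [monomial_eq_sum_descendentOrdering]
  refine Finset.sum_nbij DescendentOrdering.flag
    (fun σ _ => mem_desc_iff_exists_flag_eq.2 ⟨σ, rfl⟩) DescendentOrdering.flag_injective.injOn
    (fun F hF => ?_) fun σ _ => ?_
  · simpa using mem_desc_iff_exists_flag_eq.1 hF
  · rw [DescendentOrdering.relSign_flag, DescendentOrdering.index_flag]

end DescendentOrdering

end HyperplaneArrangement

theorem mainTheorem4_general {n l : ℕ} (A : HyperplaneArrangement n l) (i : Fin n → Fin l) :
    (∀ F ∈ A.desc i, A.IsNBC F.index) ∧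
    Set.InjOn (fun F : A.Flag => F.index) (A.desc i) ∧
    A.monomial i = ∑ F ∈ A.desc i, F.relSign i • A.monomial F.index :=
  ⟨fun _ => HyperplaneArrangement.isNBC_index_of_mem_desc,
    HyperplaneArrangement.injOn_index_desc, HyperplaneArrangement.monomial_eq_sum_desc i⟩

theorem mainTheorem4 {n l : ℕ} (A : HyperplaneArrangement n l) (i : Fin n → Fin l)
    (hi : LinearIndependent ℂ fun k => A.form (i k)) :
    (∀ F ∈ A.desc i, A.IsNBC F.index) ∧
    Set.InjOn (fun F : A.Flag => F.index) (A.desc i) ∧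
    A.monomial i = ∑ F ∈ A.desc i, F.relSign i • A.monomial F.index :=
  mainTheorem4_general A i
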